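/- Let $n\ge 1$, let $G=GL(n)$ be the complex general linear group, let $B\subset G$ be the Borel subgroup of upper triangular matrices, and let $\mathcal{B}_n$ be the flag variety of $G$, that is, the variety of full flags in $\mathbb{C}^n$ with the natural action of $G$. Let $e_1,\dots,e_n$ be the standard basis of $\mathbb{C}^n$ and fix $i\in\{1,\dots,n\}$. Let $S_i=\mathrm{Stab}_B([e_i])$ be the stabilizer in $B$ of the line $[e_i]\in\mathbb{P}^{n-1}$ through $e_i$. For an ordered basis $v_1,\dots,v_n$ of $\mathbb{C}^n$, write $(v_1\subset v_2\subset\dots\subset v_n)$ for the full flag whose $k$-dimensional member is $\mathrm{span}\{v_1,\dots,v_k\}$, and let $B^i\subset G$ be the Borel subgroup that stabilizes the flag $$\mathcal{E}^i=(e_i\subset e_1\subset\dots\subset e_{i-1}\subset e_{i+1}\subset\dots\subset e_n).$$ Then the following hold. 1. For every $\mathfrak{b}'\in\mathcal{B}_n$, $\; S_i\cdot\mathfrak{b}' = (B\cdot\mathfrak{b}')\cap(B^i\cdot\mathfrak{b}')$. In particular, every $S_i$-orbit on $\mathcal{B}_n$ is the intersection of a $B$-orbit and a $B^i$-orbit.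 2. The $S_i$-orbits on $\mathcal{B}_n$ are precisely the nonempty intersections $Q_1\cap Q_2$ of a $B$-orbit $Q_1$ and a $B^i$-orbit $Q_2$ on $\mathcal{B}_n$. 3. The $i$-Shareshian map $Q\mapsto (B\cdot Q,\,B^i\cdot Q)$ is a bijection from the set of $S_i$-orbits on $\mathcal{B}_n$ onto the set of pairs $(Q_1,Q_2)$ of a $B$-orbit $Q_1$ and a $B^i$-orbit $Q_2$ on $\mathcal{B}_n$ with $Q_1\cap Q_2\neq\emptyset$; its inverse is $(Q_1,Q_2)\mapsto Q_1\cap Q_2$. -/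

import Mathlib

open scoped Pointwise LinearAlgebra.Projectivization

/-- A full flag `0 = V₀ ⊂ V₁ ⊂ ⋯ ⊂ Vₙ = ℂⁿ` of subspaces of `ℂⁿ`, with `dim Vₖ = k`. The type
`FullFlag n` is the set of points of the flag variety of `GL(n)`. -/
@[ext]
structure FullFlag (n : ℕ) where
  /-- the subspace of dimension `k` -/
  subspace : Fin (n + 1) → Submodule ℂ (Fin n → ℂ)
  mono : Monotone subspace
  finrank_subspace : ∀ k, Module.finrank ℂ (subspace k) = (k : ℕ)

namespace FullFlag

/-- The action of `GL(n)` on full flags: `g • (V₀ ⊂ ⋯ ⊂ Vₙ) = (g V₀ ⊂ ⋯ ⊂ g Vₙ)`. -/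
noncomputable instance instMulAction (n : ℕ) :
    MulAction (Matrix.GeneralLinearGroup (Fin n) ℂ) (FullFlag n) where
  smul g F :=
    { subspace := fun k =>
        (F.subspace k).map (Matrix.GeneralLinearGroup.toLin g).toLinearEquiv.toLinearMap
      mono := fun _ _ h => Submodule.map_mono (F.mono h)
      finrank_subspace := fun k =>
        (LinearEquiv.finrank_map_eq (Matrix.GeneralLinearGroup.toLin g).toLinearEquiv
          (F.subspace k)).trans (F.finrank_subspace k) }
  one_smul F := by
    refine FullFlag.ext (funext fun k => ?_)
    change (F.subspace k).map
      (Matrix.GeneralLinearGroup.toLin 1).toLinearEquiv.toLinearMap = F.subspace k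
    rw [map_one]
    exact Submodule.map_id _
  mul_smul g h F := by
    refine FullFlag.ext (funext fun k => ?_)
    change (F.subspace k).map
        (Matrix.GeneralLinearGroup.toLin (g * h)).toLinearEquiv.toLinearMap =
      ((F.subspace k).map (Matrix.GeneralLinearGroup.toLin h).toLinearEquiv.toLinearMap).map
        (Matrix.GeneralLinearGroup.toLin g).toLinearEquiv.toLinearMap
    rw [map_mul, ← Submodule.map_comp]
    rfl

/-- The flag `(v₁ ⊂ v₂ ⊂ ⋯ ⊂ vₙ)` attached to an ordered basis `v` of `ℂⁿ`: its `k`-th subspace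
is the span of the first `k` basis vectors. -/
noncomputable def ofBasis {n : ℕ} (v : Module.Basis (Fin n) ℂ (Fin n → ℂ)) : FullFlag n where
  subspace := v.flag
  mono := v.flag_mono
  finrank_subspace k := by
    have h : (v '' {j : Fin n | j.castSucc < k}) =
        Set.range (v ∘ (Subtype.val : {j : Fin n // j.castSucc < k} → Fin n)) := by
      rw [Set.image_eq_range]
      rfl
    have hc : Fintype.card {j : Fin n // j.castSucc < k} = (k : ℕ) := by
      rw [Fintype.card_subtype]
      have := Fin.card_filter_val_lt (n := n) (m := (k : ℕ))
      have h2 := k.is_le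
      simp only [Fin.lt_def, Fin.val_castSucc]
      omega
    rw [Module.Basis.flag, h,
      finrank_span_eq_card (v.linearIndependent.comp _ Subtype.val_injective), hc]

end FullFlag

/-- The basis `e_i, e_1, …, e_{i-1}, e_{i+1}, …, e_n` of `ℂⁿ`, in this order, where `e` is the
standard basis. (`Fin.cycleRange i` is the permutation that sends the index `i` to the first
position, raises the indices below `i` by one and fixes the indices above `i`.) -/
noncomputable def basisE {n : ℕ} (i : Fin n) : Module.Basis (Fin n) ℂ (Fin n → ℂ) :=
  (Pi.basisFun ℂ (Fin n)).reindex (Fin.cycleRange i)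

/-- The flag `(e_i ⊂ e_1 ⊂ ⋯ ⊂ e_{i-1} ⊂ e_{i+1} ⊂ ⋯ ⊂ e_n)`. -/
noncomputable def flagE {n : ℕ} (i : Fin n) : FullFlag n :=
  FullFlag.ofBasis (basisE i)

/-- The standard Borel subgroup of upper triangular matrices in `GL(n)`. -/
def upperBorel (n : ℕ) : Subgroup (Matrix.GeneralLinearGroup (Fin n) ℂ) where
  carrier := {g | (g : Matrix (Fin n) (Fin n) ℂ).BlockTriangular id}
  one_mem' := Matrix.blockTriangular_one
  mul_mem' := fun ha hb => Matrix.BlockTriangular.mul ha hb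
  inv_mem' := fun {g} hg => by
    have : Invertible (g : Matrix (Fin n) (Fin n) ℂ) := g.invertible
    have h := Matrix.blockTriangular_inv_of_blockTriangular
      (M := (g : Matrix (Fin n) (Fin n) ℂ)) hg
    rw [← Matrix.coe_units_inv] at h
    exact h

/-- The Borel subgroup of `GL(n)` that stabilizes the flag
`(e_i ⊂ e_1 ⊂ ⋯ ⊂ e_{i-1} ⊂ e_{i+1} ⊂ ⋯ ⊂ e_n)`. -/
noncomputable def borelE {n : ℕ} (i : Fin n) :
    Subgroup (Matrix.GeneralLinearGroup (Fin n) ℂ) :=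
  MulAction.stabilizer (Matrix.GeneralLinearGroup (Fin n) ℂ) (flagE i)

/-- The point `[e_i]` of the projective space of `ℂⁿ`: the line through the `i`-th standard
basis vector. -/
noncomputable def lineE {n : ℕ} (i : Fin n) : ℙ ℂ (Fin n → ℂ) :=
  Projectivization.mk ℂ (Pi.single i 1)
    (fun h => one_ne_zero (Pi.single_eq_zero_iff.mp h))

/-- The stabilizer of the line `[e_i]` in the group of upper triangular matrices. -/
noncomputable def stabE {n : ℕ} (i : Fin n) :
    Subgroup (Matrix.GeneralLinearGroup (Fin n) ℂ) :=
  upperBorel n ⊓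
    (MulAction.stabilizer (LinearMap.GeneralLinearGroup ℂ (Fin n → ℂ)) (lineE i)).comap
      (Matrix.GeneralLinearGroup.toLin :
        Matrix.GeneralLinearGroup (Fin n) ℂ ≃*
          LinearMap.GeneralLinearGroup ℂ (Fin n → ℂ)).toMonoidHom

/-- The set of all orbits of a subgroup `H` of `GL(n)` on the flag variety. -/
def flagOrbits {n : ℕ} (H : Subgroup (Matrix.GeneralLinearGroup (Fin n) ℂ)) :
    Set (Set (FullFlag n)) :=
  Set.range fun F : FullFlag n => MulAction.orbit H F

/-- Geometric `i`-Shareshian pairs: pairs of an orbit of the upper triangular group and an orbit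
of `borelE i` whose intersection is nonempty. -/
def shareshianPairs {n : ℕ} (i : Fin n) : Set (Set (FullFlag n) × Set (FullFlag n)) :=
  {P | P.1 ∈ flagOrbits (upperBorel n) ∧ P.2 ∈ flagOrbits (borelE i) ∧ (P.1 ∩ P.2).Nonempty}

/-- The `i`-Shareshian map `Q ↦ (B · Q, Bⁱ · Q)`, where `H · Q = {h • F | h ∈ H, F ∈ Q}`. -/
noncomputable def shareshianMap {n : ℕ} (i : Fin n) (Q : Set (FullFlag n)) :
    Set (FullFlag n) × Set (FullFlag n) :=
  ((upperBorel n : Set (Matrix.GeneralLinearGroup (Fin n) ℂ)) • Q,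
    (borelE i : Set (Matrix.GeneralLinearGroup (Fin n) ℂ)) • Q)

/-!
Write `E` for the standard flag and `v = e_i`. The group `stabE i` lies in `borelE i`, since each
member of the flag stabilized by the latter is a member of `E`, or the line `[v]` plus one
(`FullFlag.flagE_subspace_of_lt`, `FullFlag.flagE_subspace_succ_of_le`). The content of the theorem
is the converse: if `b • F = c • F` with `b` upper triangular and `c` in `borelE i`, then some
element of `stabE i` also carries `F` to `b • F`. It suffices to find `g` in the common
stabilizer of `E` and `F` with `g v = b⁻¹ v`, for then `b g` fixes `v`.

* Comparing dimensions of sums of members of the flags shows that `v` and `b⁻¹ v` lie in the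
  same sums `E_k + F_j` (`FullFlag.single_mem_sup_iff`).
* By the Bruhat decomposition (`FullFlag.exists_bruhat`) there is a basis adapted to both `E` and
  `F`. The endomorphisms preserving `E` and `F` then form the incidence algebra of a partial order
  on the basis, the intersection of two linear orders, and the sums `E_k + F_j` containing a vector
  determine the lower set generated by its support. Two vectors with the same such lower set are
  related by an invertible element of the incidence algebra
  (`FullFlag.exists_mulVec_eq_of_lowerClosure_support`). This provides `g`
  (`FullFlag.exists_mulVec_eq_of_mem_sup_iff`).

The statements about the Shareshian map follow formally from this equality of orbits.
-/

namespace FullFlag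

variable {n : ℕ}

/-! ### The action on flags -/

theorem mem_smul_subspace {g : Matrix.GeneralLinearGroup (Fin n) ℂ} {F : FullFlag n}
    {k : Fin (n + 1)} {x : Fin n → ℂ} :
    x ∈ (g • F).subspace k ↔ ∃ y ∈ F.subspace k, g.1.mulVec y = x :=
  Iff.rfl

theorem mulVec_mem_smul {g : Matrix.GeneralLinearGroup (Fin n) ℂ} {F : FullFlag n}
    {k : Fin (n + 1)} {x : Fin n → ℂ} (hx : x ∈ F.subspace k) :
    g.1.mulVec x ∈ (g • F).subspace k :=
  ⟨x, hx, rfl⟩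

theorem subspace_zero (F : FullFlag n) : F.subspace 0 = ⊥ :=
  Submodule.finrank_eq_zero.mp (F.finrank_subspace 0)

theorem subspace_last (F : FullFlag n) : F.subspace (Fin.last n) = ⊤ :=
  Submodule.eq_top_of_finrank_eq (by simp [F.finrank_subspace])

theorem eq_of_subspace_le {F F' : FullFlag n} (h : ∀ k, F.subspace k ≤ F'.subspace k) :
    F = F' :=
  FullFlag.ext <| funext fun k =>
    Submodule.eq_of_le_of_finrank_eq (h k) (by rw [F.finrank_subspace, F'.finrank_subspace])

theorem smul_eq_self_of_mulVec_mem {g : Matrix.GeneralLinearGroup (Fin n) ℂ} {F : FullFlag n}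
    (h : ∀ k, ∀ x ∈ F.subspace k, g.1.mulVec x ∈ F.subspace k) : g • F = F := by
  refine eq_of_subspace_le fun k x hx => ?_
  obtain ⟨y, hy, rfl⟩ := mem_smul_subspace.mp hx
  exact h k y hy

theorem smul_subspace_sup (g : Matrix.GeneralLinearGroup (Fin n) ℂ) (F F' : FullFlag n)
    (k j : Fin (n + 1)) :
    (g • F).subspace k ⊔ (g • F').subspace j = (F.subspace k ⊔ F'.subspace j).map
      (Matrix.GeneralLinearGroup.toLin g).toLinearEquiv.toLinearMap :=
  (Submodule.map_sup _ _ _).symm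

theorem finrank_smul_sup (g : Matrix.GeneralLinearGroup (Fin n) ℂ) (F F' : FullFlag n)
    (k j : Fin (n + 1)) :
    Module.finrank ℂ ↥((g • F).subspace k ⊔ (g • F').subspace j) =
      Module.finrank ℂ ↥(F.subspace k ⊔ F'.subspace j) := by
  rw [smul_subspace_sup]
  exact LinearEquiv.finrank_map_eq (Matrix.GeneralLinearGroup.toLin g).toLinearEquiv _

theorem mulVec_mem_smul_sup_iff {g : Matrix.GeneralLinearGroup (Fin n) ℂ} {F F' : FullFlag n}
    {k j : Fin (n + 1)} {x : Fin n → ℂ} :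
    g.1.mulVec x ∈ (g • F).subspace k ⊔ (g • F').subspace j ↔
      x ∈ F.subspace k ⊔ F'.subspace j := by
  rw [smul_subspace_sup]
  exact (Matrix.GeneralLinearGroup.toLin g).toLinearEquiv.injective.mem_set_image

theorem mulVec_inv_mulVec (g : Matrix.GeneralLinearGroup (Fin n) ℂ) (x : Fin n → ℂ) :
    g.1.mulVec ((g⁻¹).1.mulVec x) = x := by
  rw [Matrix.mulVec_mulVec, ← Units.val_mul, mul_inv_cancel]
  exact Matrix.one_mulVec x

/-! ### Coordinate flags -/

/-- The flag of the standard basis, stabilized by `upperBorel n`. -/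
noncomputable def standard (n : ℕ) : FullFlag n :=
  ofBasis (Pi.basisFun ℂ (Fin n))

theorem mem_span_single_image {s : Set (Fin n)} {x : Fin n → ℂ} :
    x ∈ Submodule.span ℂ ((fun a => Pi.single a (1 : ℂ)) '' s) ↔ ∀ a, a ∉ s → x a = 0 := by
  have h : (fun a => Pi.single a (1 : ℂ)) = (Pi.basisFun ℂ (Fin n)) := by
    ext a : 1
    simp
  rw [h, Module.Basis.mem_span_image]
  simp only [Set.subset_def, Finset.mem_coe, Finsupp.mem_support_iff, Pi.basisFun_repr]
  exact forall_congr' fun a => not_imp_comm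

theorem mem_standard_subspace {k : Fin (n + 1)} {x : Fin n → ℂ} :
    x ∈ (standard n).subspace k ↔ ∀ a : Fin n, k ≤ a.castSucc → x a = 0 := by
  have h : (standard n).subspace k =
      Submodule.span ℂ ((fun a => Pi.single a (1 : ℂ)) '' {a : Fin n | a.castSucc < k}) := by
    simp [standard, ofBasis, Module.Basis.flag]
  rw [h, mem_span_single_image]
  simp

theorem mem_flagE_subspace {i : Fin n} {k : Fin (n + 1)} {x : Fin n → ℂ} :
    x ∈ (flagE i).subspace k ↔ ∀ a : Fin n, k ≤ (Fin.cycleRange i a).castSucc → x a = 0 := by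
  have h : (flagE i).subspace k = Submodule.span ℂ
      ((fun a => Pi.single a (1 : ℂ)) '' {a : Fin n | (Fin.cycleRange i a).castSucc < k}) := by
    have hs : {a : Fin n | (Fin.cycleRange i a).castSucc < k} =
        (Fin.cycleRange i).symm '' {a : Fin n | a.castSucc < k} := by
      ext a
      simp [Equiv.image_symm_eq_preimage]
    rw [hs, Set.image_image]
    simp [flagE, ofBasis, Module.Basis.flag, basisE]
  rw [h, mem_span_single_image]
  simp

theorem flagE_subspace_of_lt {i : Fin n} {k : Fin (n + 1)} (h : i.castSucc < k) :
    (flagE i).subspace k = (standard n).subspace k := by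
  ext x
  rw [mem_flagE_subspace, mem_standard_subspace]
  refine forall_congr' fun a => ?_
  have : k ≤ (Fin.cycleRange i a).castSucc ↔ k ≤ a.castSucc := by
    rcases lt_trichotomy a i with h1 | h1 | h1
    · simp only [Fin.le_def, Fin.lt_def, Fin.val_castSucc, Fin.coe_cycleRange_of_lt h1] at *
      omega
    · subst h1
      have : NeZero n := ⟨by have := a.2; omega⟩
      rw [Fin.cycleRange_self]
      simp only [Fin.le_def, Fin.lt_def, Fin.val_castSucc, Fin.val_zero] at *
      omega
    · rw [Fin.cycleRange_of_gt h1]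
  rw [this]

theorem flagE_subspace_succ_of_le {i k : Fin n} (h : k ≤ i) :
    (flagE i).subspace k.succ =
      Submodule.span ℂ {Pi.single i (1 : ℂ)} ⊔ (standard n).subspace k.castSucc := by
  have h' : Submodule.span ℂ {Pi.single i (1 : ℂ)} ⊔ (standard n).subspace k.castSucc =
      Submodule.span ℂ ((fun a => Pi.single a (1 : ℂ)) '' insert i {a | a < k}) := by
    rw [Set.image_insert_eq, Submodule.span_insert]
    congr 1
    ext x
    rw [mem_standard_subspace, mem_span_single_image]
    simp
  rw [h']
  ext x
  rw [mem_flagE_subspace, mem_span_single_image]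
  refine forall_congr' fun a => ?_
  have : k.succ ≤ (Fin.cycleRange i a).castSucc ↔ a ∉ insert i {a | a < k} := by
    simp only [Set.mem_insert_iff, Set.mem_ofPred_eq, not_or, not_lt, Fin.le_def, Fin.val_succ,
      Fin.val_castSucc]
    rcases lt_trichotomy a i with h1 | h1 | h1
    · rw [Fin.coe_cycleRange_of_lt h1]
      have := h1.ne
      omega
    · subst h1
      have : NeZero n := ⟨by have := a.2; omega⟩
      rw [Fin.cycleRange_self]
      simp
    · rw [Fin.cycleRange_of_gt h1]
      have := h1.ne'
      simp only [Fin.le_def, Fin.lt_def] at *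
      omega
  rw [this]

/-! ### Stabilizers -/

theorem smul_standard {g : Matrix.GeneralLinearGroup (Fin n) ℂ} (hg : g ∈ upperBorel n) :
    g • standard n = standard n := by
  refine smul_eq_self_of_mulVec_mem fun k x hx => ?_
  rw [mem_standard_subspace] at hx ⊢
  intro a ha
  rw [Matrix.mulVec, dotProduct]
  refine Finset.sum_eq_zero fun b _ => ?_
  rcases lt_or_ge b a with h | h
  · rw [show g.1 a b = 0 from hg h, zero_mul]
  · rw [hx b (ha.trans (Fin.castSucc_le_castSucc_iff.mpr h)), mul_zero]

theorem mem_stabE {i : Fin n} {g : Matrix.GeneralLinearGroup (Fin n) ℂ} :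
    g ∈ stabE i ↔ g ∈ upperBorel n ∧
      ∃ c : ℂ, g.1.mulVec (Pi.single i 1) = c • Pi.single i 1 := by
  have hl : Matrix.GeneralLinearGroup.toLin g • lineE i = lineE i ↔
      ∃ c : ℂ, c • Pi.single i 1 = g.1.mulVec (Pi.single i 1) := by
    rw [lineE, Projectivization.smul_mk, Projectivization.mk_eq_mk_iff']
    rfl
  refine and_congr_right fun _ => hl.trans (exists_congr fun c => eq_comm)

theorem stabE_le_borelE (i : Fin n) : stabE i ≤ borelE i := by
  intro g hg
  obtain ⟨hB, c, hc⟩ := mem_stabE.mp hg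
  have hE {k : Fin (n + 1)} {x : Fin n → ℂ} (hx : x ∈ (standard n).subspace k) :
      g.1.mulVec x ∈ (standard n).subspace k := by
    have := mulVec_mem_smul (g := g) hx
    rwa [smul_standard hB] at this
  refine smul_eq_self_of_mulVec_mem fun k => ?_
  rcases lt_or_ge i.castSucc k with h | h
  · rw [flagE_subspace_of_lt h]
    exact fun x hx => hE hx
  · induction k using Fin.cases with
    | zero => simp [subspace_zero]
    | succ k =>
      rw [flagE_subspace_succ_of_le (Fin.le_def.mpr (by
        simp only [Fin.le_def, Fin.val_succ, Fin.val_castSucc] at h; omega))]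
      intro x hx
      obtain ⟨y, hy, z, hz, rfl⟩ := Submodule.mem_sup.mp hx
      obtain ⟨d, rfl⟩ := Submodule.mem_span_singleton.mp hy
      rw [Matrix.mulVec_add, Matrix.mulVec_smul, hc]
      exact add_mem (Submodule.mem_sup_left (Submodule.smul_mem _ _
        (Submodule.smul_mem _ _ (Submodule.mem_span_singleton_self _))))
        (Submodule.mem_sup_right (hE hz))

/-! ### Incidence of the line and sums of flag members -/

/-- Whether `e_i` lies in `E_k + F_j`, for the standard flag `E`, depends only on the
`upperBorel n`-orbit and the `borelE i`-orbit of `F`: if `k ≤ i`, it says that adding the line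
`[e_i]` does not change the dimension, and `[e_i] + E_k` is a member of `flagE i`. -/
theorem single_mem_sup_iff {i : Fin n} {b c : Matrix.GeneralLinearGroup (Fin n) ℂ}
    (hb : b ∈ upperBorel n) (hc : c ∈ borelE i) {F : FullFlag n} (h : b • F = c • F)
    (k : Fin n) (j : Fin (n + 1)) :
    Pi.single i (1 : ℂ) ∈ (standard n).subspace k.castSucc ⊔ F.subspace j ↔
      Pi.single i (1 : ℂ) ∈ (standard n).subspace k.castSucc ⊔ (b • F).subspace j := by
  have key (W : Submodule ℂ (Fin n → ℂ)) : Pi.single i (1 : ℂ) ∈ W ↔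
      Module.finrank ℂ ↥(Submodule.span ℂ {Pi.single i (1 : ℂ)} ⊔ W) = Module.finrank ℂ W := by
    rw [← Submodule.span_singleton_le_iff_mem, ← sup_eq_right]
    exact ⟨fun h => by rw [h],
      fun h => (Submodule.eq_of_le_of_finrank_eq le_sup_right h.symm).symm⟩
  rcases lt_or_ge i k with hik | hik
  · have hmem : Pi.single i (1 : ℂ) ∈ (standard n).subspace k.castSucc := by
      rw [mem_standard_subspace]
      exact fun a ha => Pi.single_eq_of_ne
        (hik.trans_le (Fin.castSucc_le_castSucc_iff.mp ha)).ne' _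
    exact iff_of_true (Submodule.mem_sup_left hmem) (Submodule.mem_sup_left hmem)
  · have h1 := finrank_smul_sup b (standard n) F k.castSucc j
    have h2 := finrank_smul_sup c (flagE i) F k.succ j
    rw [smul_standard hb] at h1
    rw [show c • flagE i = flagE i from hc, ← h] at h2
    rw [key, key, ← sup_assoc, ← sup_assoc, ← flagE_subspace_succ_of_le hik, h1, h2]

/-! ### Bruhat decomposition and the common stabilizer of two flags -/

theorem exists_mem_upperBorel {M : Matrix (Fin n) (Fin n) ℂ} (hM : M.BlockTriangular id)
    (hd : ∀ a, M a a ≠ 0) : ∃ g ∈ upperBorel n, g.1 = M := by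
  have hdet : M.det ≠ 0 := by
    rw [Matrix.det_of_isUpperTriangular hM]
    exact Finset.prod_ne_zero_iff.mpr fun a _ => hd a
  exact ⟨Matrix.GeneralLinearGroup.mkOfDetNeZero M hdet, hM, rfl⟩

/-- A form of the Bruhat decomposition: every full flag is moved by an upper triangular matrix to
a coordinate flag. The column `b e_a` is a vector with last nonzero coordinate `a` that lies in
the smallest possible member `F_{σ a + 1}` of the flag. -/
theorem exists_bruhat (F : FullFlag n) :
    ∃ b ∈ upperBorel n, ∃ σ : Fin n → Fin n, ∀ (j : Fin (n + 1)) (y : Fin n → ℂ),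
      b.1.mulVec y ∈ F.subspace j ↔ ∀ a, j ≤ (σ a).castSucc → y a = 0 := by
  let P (a : Fin n) (j : Fin (n + 1)) : Prop :=
    ∃ x ∈ F.subspace j, x a ≠ 0 ∧ ∀ c, a < c → x c = 0
  have hP (a : Fin n) : ∃ s : Fin n, P a s.succ ∧ ¬ P a s.castSucc := by
    by_contra! hcon
    have hnot : ∀ j, ¬ P a j := by
      intro j
      induction j using Fin.induction with
      | zero =>
        rintro ⟨x, hx, hxa, -⟩
        rw [subspace_zero, Submodule.mem_bot] at hx
        exact hxa (by rw [hx]; rfl)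
      | succ s ih => exact fun h => ih (hcon s h)
    refine hnot (Fin.last n) ⟨Pi.single a 1, by simp [subspace_last], by simp, ?_⟩
    exact fun c hc => Pi.single_eq_of_ne hc.ne' _
  choose σ hσ hσ' using hP
  choose u huF hua hu0 using hσ
  obtain ⟨b, hb, hbM⟩ := exists_mem_upperBorel (M := Matrix.of fun a c => u c a)
    (fun a c hac => hu0 c a hac) hua
  have hsum (y : Fin n → ℂ) : b.1.mulVec y = ∑ a, y a • u a := by
    rw [hbM]
    ext c
    simp [Matrix.mulVec, dotProduct, mul_comm]
  refine ⟨b, hb, σ, fun j y => ⟨fun hy => ?_, fun hy => ?_⟩⟩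
  · suffices H : ∀ k : ℕ, ∀ y : Fin n → ℂ, (∀ a : Fin n, k ≤ a → y a = 0) →
        b.1.mulVec y ∈ F.subspace j → ∀ a, j ≤ (σ a).castSucc → y a = 0 from
      H n y (fun a ha => absurd a.2 (by omega)) hy
    intro k
    induction k with
    | zero => exact fun y hy _ a _ => hy a (Nat.zero_le _)
    | succ k ih =>
      intro y hy hyF
      by_cases hk : ∀ a : Fin n, (a : ℕ) = k → y a = 0
      · exact ih y (fun a ha => ha.eq_or_lt.elim (fun h => hk a h.symm) (hy a)) hyF
      push Not at hk
      obtain ⟨a, rfl, hya⟩ := hk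
      -- `b y` has last nonzero coordinate `a`, so minimality of `σ a` puts `b e_a` in `F_j`.
      have hPa : P a j := by
        refine ⟨_, hyF, ?_, fun c hc => ?_⟩
        · rw [hsum, Finset.sum_apply, Finset.sum_eq_single a]
          · exact mul_ne_zero hya (hua a)
          · intro d _ hda
            rcases lt_or_gt_of_ne hda with h | h
            · simp [hu0 d a h]
            · simp [hy d h]
          · simp
        · rw [hsum, Finset.sum_apply]
          refine Finset.sum_eq_zero fun d _ => ?_
          rcases lt_or_ge a d with h | h
          · simp [hy d h]
          · simp [hu0 d c (h.trans_lt hc)]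
      have hja : (σ a).castSucc < j := by
        by_contra! hja
        obtain ⟨x, hx, hx'⟩ := hPa
        exact hσ' a ⟨x, F.mono hja hx, hx'⟩
      have hsingle : b.1.mulVec (Pi.single a (y a)) = y a • u a := by
        rw [hsum, Finset.sum_eq_single a (fun d _ hd => by simp [hd]) (by simp)]
        simp
      have hrec := ih (y - Pi.single a (y a)) (fun c hc => ?_) ?_
      · intro c hc
        have hca : c ≠ a := fun h => (h ▸ hc).not_gt hja
        simpa [hca] using hrec c hc
      · rcases eq_or_ne c a with rfl | hca
        · simp
        · have := Fin.val_ne_of_ne hca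
          simp [hca, hy c (by omega)]
      · rw [Matrix.mulVec_sub, hsingle]
        exact sub_mem hyF (Submodule.smul_mem _ _
          (F.mono (Fin.castSucc_lt_iff_succ_le.mp hja) (huF a)))
  · rw [hsum]
    refine sum_mem fun a _ => ?_
    rcases le_or_gt j (σ a).castSucc with h | h
    · rw [hy a h, zero_smul]
      exact zero_mem _
    · exact Submodule.smul_mem _ _ (F.mono (Fin.castSucc_lt_iff_succ_le.mp h) (huF a))

/-- If the supports of `v` and `v'` generate the same lower set for the partial order pulled back
along `f`, then `v'` is the image of `v` under a matrix in the incidence algebra of that order with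
nonzero diagonal. The matrix is built row by row: if some `b` strictly above `a` has `v b ≠ 0`, an
entry in column `b` corrects row `a`; otherwise `v a` and `v' a` are both zero or both
nonzero, and scaling suffices. -/
theorem exists_mulVec_eq_of_lowerClosure_support {ι α K : Type*} [Fintype ι]
    [DecidableEq ι] [PartialOrder α] [Field K] {f : ι → α} (hf : Function.Injective f)
    {v v' : ι → K}
    (h : ∀ a, (∃ b, f a ≤ f b ∧ v b ≠ 0) ↔ ∃ b, f a ≤ f b ∧ v' b ≠ 0) :
    ∃ X : Matrix ι ι K, (∀ a b, X a b ≠ 0 → f a ≤ f b) ∧ (∀ a, X a a ≠ 0) ∧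
      X.mulVec v = v' := by
  have hrow (a : ι) : ∃ r : ι → K, (∀ b, r b ≠ 0 → f a ≤ f b) ∧ r a ≠ 0 ∧ r ⬝ᵥ v = v' a := by
    by_cases hb : ∃ b, b ≠ a ∧ f a ≤ f b ∧ v b ≠ 0
    · obtain ⟨b, hba, hab, hvb⟩ := hb
      refine ⟨Pi.single a 1 + Pi.single b ((v' a - v a) / v b), fun c hc => ?_, ?_, ?_⟩
      · rcases eq_or_ne c a with rfl | hca
        · exact le_rfl
        rcases eq_or_ne c b with rfl | hcb
        · exact hab
        · simp [hca, hcb] at hc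
      · simp [hba.symm]
      · rw [add_dotProduct, single_dotProduct, single_dotProduct, div_mul_cancel₀ _ hvb]
        ring
    · push Not at hb
      have hb' : ∀ b, f a ≤ f b → v b ≠ 0 → b = a := fun b h1 h2 =>
        by_contra fun h3 => h2 (hb b h3 h1)
      have hiff : v a ≠ 0 ↔ v' a ≠ 0 := by
        constructor
        · intro hva
          obtain ⟨b, hab, hvb⟩ := (h a).mp ⟨a, le_rfl, hva⟩
          obtain ⟨c, hbc, hvc⟩ := (h b).mpr ⟨b, le_rfl, hvb⟩
          obtain rfl := hb' c (hab.trans hbc) hvc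
          rwa [hf (hab.antisymm hbc)]
        · intro hva
          obtain ⟨b, hab, hvb⟩ := (h a).mpr ⟨a, le_rfl, hva⟩
          rwa [← hb' b hab hvb]
      have hsupp (t : K) : ∀ b, (Pi.single a t : ι → K) b ≠ 0 → f a ≤ f b := by
        intro b hb
        rcases eq_or_ne b a with rfl | hba
        · exact le_rfl
        · simp [hba] at hb
      by_cases hva : v a = 0
      · refine ⟨Pi.single a 1, hsupp 1, by simp, ?_⟩
        have : v' a = 0 := by simpa [hva] using hiff
        simp [hva, this]
      · exact ⟨Pi.single a (v' a / v a), hsupp _, by simpa using ⟨hiff.mp hva, hva⟩,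
          by rw [single_dotProduct, div_mul_cancel₀ _ hva]⟩
  choose X hX hXd hXv using hrow
  exact ⟨X, hX, hXd, funext hXv⟩

/-- The stabilizer of `F` in the upper triangular group acts transitively on the vectors with given
incidence to the sums `E_k + F_j`, where `E` is the standard flag. -/
theorem exists_mulVec_eq_of_mem_sup_iff (F : FullFlag n) {v v' : Fin n → ℂ}
    (h : ∀ (k : Fin n) (j : Fin (n + 1)),
      v ∈ (standard n).subspace k.castSucc ⊔ F.subspace j ↔
        v' ∈ (standard n).subspace k.castSucc ⊔ F.subspace j) :
    ∃ g ∈ upperBorel n, g • F = F ∧ g.1.mulVec v = v' := by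
  obtain ⟨b, hb, σ, hσ⟩ := exists_bruhat F
  have hbb := mulVec_inv_mulVec b
  have hE (k : Fin (n + 1)) (y : Fin n → ℂ) :
      b.1.mulVec y ∈ (standard n).subspace k ↔ y ∈ (standard n).subspace k := by
    have := mulVec_mem_smul_sup_iff (g := b) (F := standard n) (F' := standard n) (k := k)
      (j := k) (x := y)
    rwa [smul_standard hb, sup_idem] at this
  have hsup (k : Fin n) (j : Fin (n + 1)) (x : Fin n → ℂ) :
      x ∉ (standard n).subspace k.castSucc ⊔ F.subspace j ↔
        ∃ a, k ≤ a ∧ j ≤ (σ a).castSucc ∧ (b⁻¹).1.mulVec x a ≠ 0 := by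
    rw [not_iff_comm]
    push Not
    constructor
    · intro hx
      rw [← hbb x]
      set y := (b⁻¹).1.mulVec x
      have hy : y = (fun a => if k ≤ a then 0 else y a) + fun a => if k ≤ a then y a else 0 := by
        ext a
        by_cases ha : k ≤ a <;> simp [ha]
      rw [hy, Matrix.mulVec_add]
      refine Submodule.add_mem_sup ((hE _ _).mpr ?_) ((hσ _ _).mpr fun a ha => ?_)
      · rw [mem_standard_subspace]
        intro a ha
        simp [Fin.castSucc_le_castSucc_iff.mp ha]
      · by_cases hka : k ≤ a
        · simpa [hka] using hx a hka ha
        · simp [hka]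
    · intro hx a hka hja
      obtain ⟨y, hy, z, hz, rfl⟩ := Submodule.mem_sup.mp hx
      rw [← hbb y, hE, mem_standard_subspace] at hy
      rw [← hbb z, hσ] at hz
      rw [Matrix.mulVec_add, Pi.add_apply, hy a (Fin.castSucc_le_castSucc_iff.mpr hka), hz a hja,
        add_zero]
  obtain ⟨X, hX, hXd, hXv⟩ := exists_mulVec_eq_of_lowerClosure_support
    (f := fun a : Fin n => (a, σ a)) (fun a c hac => congrArg Prod.fst hac)
    (v := (b⁻¹).1.mulVec v) (v' := (b⁻¹).1.mulVec v') fun a => by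
      have := not_congr (h a (σ a).castSucc)
      rw [hsup, hsup] at this
      simpa [Prod.le_def, and_assoc] using this
  obtain ⟨x, hx, rfl⟩ := exists_mem_upperBorel (M := X)
    (fun a c hca => by_contra fun hne => (hX a c hne).1.not_gt hca) hXd
  refine ⟨b * x * b⁻¹, mul_mem (mul_mem hb hx) (inv_mem hb),
    smul_eq_self_of_mulVec_mem fun j y hy => ?_, ?_⟩
  · rw [← hbb y, hσ] at hy
    simp only [Units.val_mul, ← Matrix.mulVec_mulVec]
    rw [hσ]
    intro a ha
    rw [Matrix.mulVec, dotProduct]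
    refine Finset.sum_eq_zero fun c _ => ?_
    by_cases hxc : x.1 a c = 0
    · rw [hxc, zero_mul]
    · rw [hy c (ha.trans (Fin.castSucc_le_castSucc_iff.mpr (hX a c hxc).2)), mul_zero]
  · simp only [Units.val_mul, ← Matrix.mulVec_mulVec]
    rw [hXv, hbb]

/-! ### Orbits -/

theorem orbit_stabE (i : Fin n) (F : FullFlag n) :
    MulAction.orbit (stabE i) F =
      MulAction.orbit (upperBorel n) F ∩ MulAction.orbit (borelE i) F := by
  refine Set.Subset.antisymm ?_ ?_
  · rintro _ ⟨⟨s, hs⟩, rfl⟩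
    exact ⟨⟨⟨s, hs.1⟩, rfl⟩, ⟨⟨s, stabE_le_borelE i hs⟩, rfl⟩⟩
  · rintro _ ⟨⟨⟨b, hb⟩, rfl⟩, ⟨⟨c, hc⟩, hcb⟩⟩
    have hcb : b • F = c • F := hcb.symm
    have hinv (k : Fin n) (j : Fin (n + 1)) :
        Pi.single i (1 : ℂ) ∈ (standard n).subspace k.castSucc ⊔ (b • F).subspace j ↔
          (b⁻¹).1.mulVec (Pi.single i 1) ∈ (standard n).subspace k.castSucc ⊔ F.subspace j := by
      have := mulVec_mem_smul_sup_iff (g := b) (F := standard n) (F' := F) (k := k.castSucc)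
        (j := j) (x := (b⁻¹).1.mulVec (Pi.single i 1))
      rwa [smul_standard hb, mulVec_inv_mulVec] at this
    -- `g` moves the line `[e_i]` to `b⁻¹ [e_i]`, so that `b g` fixes it.
    obtain ⟨g, hg, hgF, hgv⟩ := exists_mulVec_eq_of_mem_sup_iff F fun k j =>
      (single_mem_sup_iff hb hc hcb k j).trans (hinv k j)
    refine ⟨⟨b * g, mem_stabE.mpr ⟨mul_mem hb hg, 1, ?_⟩⟩, ?_⟩
    · rw [Units.val_mul, ← Matrix.mulVec_mulVec, hgv, mulVec_inv_mulVec, one_smul]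
    · change (b * g) • F = b • F
      rw [mul_smul, hgF]

end FullFlag

theorem theorem3p1 (n : ℕ) (i : Fin n) :
    -- each orbit of `stabE i` is the intersection of the two Borel orbits through the same flag
    (∀ F : FullFlag n,
      MulAction.orbit (stabE i) F =
        MulAction.orbit (upperBorel n) F ∩ MulAction.orbit (borelE i) F) ∧
    -- the orbits of `stabE i` are exactly the nonempty intersections
    flagOrbits (stabE i) =
      {Q | Q.Nonempty ∧
        ∃ Q₁ ∈ flagOrbits (upperBorel n), ∃ Q₂ ∈ flagOrbits (borelE i), Q = Q₁ ∩ Q₂} ∧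
    -- the Shareshian map is a bijection onto the geometric Shareshian pairs, with inverse
    -- given by intersection
    Set.BijOn (shareshianMap i) (flagOrbits (stabE i)) (shareshianPairs i) ∧
    Set.InvOn (fun P : Set (FullFlag n) × Set (FullFlag n) => P.1 ∩ P.2) (shareshianMap i)
      (flagOrbits (stabE i)) (shareshianPairs i) := by
  have horbit := FullFlag.orbit_stabE i
  have hsmul {H : Subgroup (Matrix.GeneralLinearGroup (Fin n) ℂ)} (hH : stabE i ≤ H)
      (F : FullFlag n) :
      (H : Set (Matrix.GeneralLinearGroup (Fin n) ℂ)) • MulAction.orbit (stabE i) F =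
        MulAction.orbit H F := by
    ext F'
    constructor
    · rintro ⟨g, hg, _, ⟨⟨s, hs⟩, rfl⟩, rfl⟩
      exact ⟨⟨g * s, mul_mem hg (hH hs)⟩, mul_smul g s F⟩
    · rintro ⟨⟨g, hg⟩, rfl⟩
      exact ⟨g, hg, F, MulAction.mem_orbit_self F, rfl⟩
  have hmap (F : FullFlag n) : shareshianMap i (MulAction.orbit (stabE i) F) =
      (MulAction.orbit (upperBorel n) F, MulAction.orbit (borelE i) F) :=
    Prod.ext (hsmul inf_le_left F) (hsmul (FullFlag.stabE_le_borelE i) F)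
  have hmem {H : Subgroup (Matrix.GeneralLinearGroup (Fin n) ℂ)} {Q : Set (FullFlag n)}
      (hQ : Q ∈ flagOrbits H) {F : FullFlag n} (hF : F ∈ Q) : Q = MulAction.orbit H F := by
    obtain ⟨F', rfl⟩ := hQ
    exact (MulAction.orbit_eq_iff.mpr hF).symm
  have hmaps : Set.MapsTo (shareshianMap i) (flagOrbits (stabE i)) (shareshianPairs i) := by
    rintro _ ⟨F, rfl⟩
    rw [hmap]
    exact ⟨⟨F, rfl⟩, ⟨F, rfl⟩, F, MulAction.mem_orbit_self F, MulAction.mem_orbit_self F⟩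
  have hinter : Set.MapsTo (fun P : Set (FullFlag n) × Set (FullFlag n) => P.1 ∩ P.2)
      (shareshianPairs i) (flagOrbits (stabE i)) := by
    rintro ⟨Q₁, Q₂⟩ ⟨h₁, h₂, F, hF₁, hF₂⟩
    refine ⟨F, ?_⟩
    change MulAction.orbit (stabE i) F = Q₁ ∩ Q₂
    rw [show Q₁ = _ from hmem h₁ hF₁, show Q₂ = _ from hmem h₂ hF₂, ← horbit]
  have hinv : Set.InvOn (fun P : Set (FullFlag n) × Set (FullFlag n) => P.1 ∩ P.2)
      (shareshianMap i) (flagOrbits (stabE i)) (shareshianPairs i) := by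
    constructor
    · rintro _ ⟨F, rfl⟩
      rw [hmap]
      exact (horbit F).symm
    · rintro ⟨Q₁, Q₂⟩ ⟨h₁, h₂, F, hF₁, hF₂⟩
      change shareshianMap i (Q₁ ∩ Q₂) = (Q₁, Q₂)
      rw [show Q₁ = _ from hmem h₁ hF₁, show Q₂ = _ from hmem h₂ hF₂, ← horbit, hmap]
  refine ⟨horbit, ?_, hinv.bijOn hmaps hinter, hinv⟩
  refine Set.Subset.antisymm ?_ ?_
  · rintro _ ⟨F, rfl⟩
    exact ⟨⟨F, MulAction.mem_orbit_self F⟩, _, ⟨F, rfl⟩, _, ⟨F, rfl⟩, horbit F⟩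
  · rintro _ ⟨hne, Q₁, h₁, Q₂, h₂, rfl⟩
    exact hinter (x := (Q₁, Q₂)) ⟨h₁, h₂, hne⟩
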